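/- Let $R$ be a commutative ring with $1$, let $M$ be a simple matroid (no loops, no two distinct parallel elements) of rank $\ell$ on $[n]=\{1,\dots,n\}$, and let $E=\Lambda V$ be the exterior algebra of the free $R$-module $V$ with basis $e_1,\dots,e_n$. For $S=\{i_1<\dots<i_p\}\subseteq[n]$ put $e_S=e_{i_1}\cdots e_{i_p}$ (so $e_\emptyset=1$), and let $\partial:E\to E$ be the $R$-linear antiderivation of degree $-1$ with $\partial e_i=1$ for every $i$, that is, $\partial(ab)=(\partial a)b+(-1)^{\deg a}a\,\partial b$ for homogeneous $a$. Let $I$ be the Orlik–Solomon ideal of $M$, i.e. the ideal of $E$ generated by all $\partial e_S$ with $S$ dependent in $M$, and let $I^0=\{a\in E : ab=0\text{ for every }b\in I\}$ be its annihilator. A broken circuit is a circuit of $M$ with its smallest element deleted. An nbc-base is a set $T\subseteq[n]$ with $|T|=\ell$ that contains no broken circuit. For an nbc-base $T=\{i_1<\dots<i_\ell\}$ let $X_p$ be the closure in $M$ of $\{i_{\ell-p+1},\dots,i_\ell\}$ for $0\le p\le\ell$, let $S_p=X_p\setminus X_{p-1}$ for $1\le p\le\ell$, and put $$z(T)=\operatorname{sign}(\sigma)\,\partial(e_{S_1})\,\partial(e_{S_2})\cdots\partial(e_{S_\ell})\in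 E,$$ where $\sigma$ is the permutation of $[n]$ that lists the elements of $S_1$ in increasing order, then those of $S_2$ in increasing order, and so on. Then the set $Z=\{z(T) : T\text{ an nbc-base of }M\}$ generates the ideal $I^0$. In particular, $I^0$ is a pure ideal, that is, it is generated by a set of products of elements of $V$ (the empty product $1$ being allowed). -/

import Mathlib

namespace OrlikSolomon

section Exterior

variable (R : Type*) [CommRing R] (n : ℕ)

/-- The exterior algebra `E = Λ V` of the free `R`-module `V = R ^ n`. -/
abbrev Ext : Type _ := ExteriorAlgebra R (Fin n → R)

variable {n}

/-- The standard generator `e_i` of `E`. -/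
noncomputable def gen (i : Fin n) : Ext R n :=
  ExteriorAlgebra.ι R (Pi.single i (1 : R) : Fin n → R)

/-- The monomial `e_S`: the product of the `e_i`, `i ∈ S`, in increasing order of the indices. -/
noncomputable def mono (S : Finset (Fin n)) : Ext R n :=
  ((S.sort (· ≤ ·)).map (gen R)).prod

variable (n)

/-- The differential `∂` of `E`, that is, the antiderivation of degree `-1` with `∂ e_i = 1` for
every `i`: contraction with the linear form on `V` that takes the value `1` at each `e_i`. -/
noncomputable def diff : Ext R n →ₗ[R] Ext R n :=
  CliffordAlgebra.contractLeft (Q := (0 : QuadraticForm R (Fin n → R)))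
    (∑ i : Fin n, LinearMap.proj i : (Fin n → R) →ₗ[R] R)

variable {R n}

theorem diff_one : diff R n 1 = 0 :=
  CliffordAlgebra.contractLeft_one (Q := (0 : QuadraticForm R (Fin n → R)))
    (∑ j : Fin n, LinearMap.proj j : (Fin n → R) →ₗ[R] R)

theorem diff_gen (i : Fin n) : diff R n (gen R i) = 1 := by
  have h := CliffordAlgebra.contractLeft_ι (Q := (0 : QuadraticForm R (Fin n → R)))
    (∑ j : Fin n, LinearMap.proj j : (Fin n → R) →ₗ[R] R) (Pi.single i (1 : R))
  refine h.trans ?_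
  simp [LinearMap.sum_apply]

/-- The Leibniz rule for a left factor of degree one. -/
theorem diff_gen_mul (i : Fin n) (b : Ext R n) :
    diff R n (gen R i * b) = b - gen R i * diff R n b := by
  have h := CliffordAlgebra.contractLeft_ι_mul (Q := (0 : QuadraticForm R (Fin n → R)))
    (∑ j : Fin n, LinearMap.proj j : (Fin n → R) →ₗ[R] R) (Pi.single i (1 : R)) b
  have h1 : (∑ j : Fin n, LinearMap.proj j : (Fin n → R) →ₗ[R] R) (Pi.single i (1 : R)) = 1 := by
    simp [LinearMap.sum_apply]
  rw [h1, one_smul] at h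
  exact h

variable (R)

/-- An element of `E` is pure if it is a product of elements of degree one
(the empty product `1` included). -/
def IsPure (a : Ext R n) : Prop :=
  ∃ l : List (Fin n → R), a = (l.map (ExteriorAlgebra.ι R)).prod

/-- An ideal of `E` is pure if it is generated by a set of pure elements. -/
def IsPureIdeal (J : Ideal (Ext R n)) : Prop :=
  ∃ P : Set (Ext R n), (∀ a ∈ P, IsPure R a) ∧ J = Ideal.span P

/-- The (left) annihilator `J⁰ = {a ∈ E | a b = 0 for every b ∈ J}` of an ideal `J` of `E`. -/
def annih (J : Ideal (Ext R n)) : Ideal (Ext R n) where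
  carrier := {a | ∀ b ∈ J, a * b = 0}
  add_mem' := fun {x y} hx hy b hb => by rw [add_mul, hx b hb, hy b hb, add_zero]
  zero_mem' := fun b _ => zero_mul b
  smul_mem' := fun c x hx b hb => by rw [smul_eq_mul, mul_assoc, hx b hb, mul_zero]

end Exterior

section Matroid

variable {n : ℕ}

/-- A simple matroid: no loops (the case `x = y`) and no two distinct parallel elements. -/
def IsSimple (M : Matroid (Fin n)) : Prop :=
  ∀ x ∈ M.E, ∀ y ∈ M.E, M.Indep {x, y}

/-- A broken circuit: a circuit with its smallest element deleted. -/
def IsBrokenCircuit (M : Matroid (Fin n)) (B : Set (Fin n)) : Prop :=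
  ∃ C : Set (Fin n), ∃ x, M.IsCircuit C ∧ IsLeast C x ∧ B = C \ {x}

/-- `T` is an nbc-set: it contains no broken circuit. -/
def IsNbc (M : Matroid (Fin n)) (T : Finset (Fin n)) : Prop :=
  ∀ B : Set (Fin n), IsBrokenCircuit M B → ¬ B ⊆ (T : Set (Fin n))

/-- `T` is an nbc-base: an nbc-set whose cardinality is the rank of the matroid. -/
def IsNbcBase (M : Matroid (Fin n)) (T : Finset (Fin n)) : Prop :=
  IsNbc M T ∧ (T.card : ℕ∞) = M.eRank

/-- The flag `∅ ⊆ X_1 ⊆ ⋯ ⊆ X_ℓ` attached to `T = {i_1 < ⋯ < i_ℓ}`: `X_p` is the closure of the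
set `{i_{ℓ-p+1}, …, i_ℓ}` of the `p` largest elements of `T`. -/
def flag (M : Matroid (Fin n)) (T : Finset (Fin n)) (p : Fin (T.card + 1)) : Set (Fin n) :=
  M.closure {x | x ∈ (T.sort (· ≤ ·)).drop (T.card - p)}

open scoped Classical in
/-- The blocks `S_p = X_p \ X_{p-1}`, `1 ≤ p ≤ k`, of a chain `X_0 ⊆ ⋯ ⊆ X_k`, in this order. -/
noncomputable def flagPartition {k : ℕ} (X : Fin (k + 1) → Set (Fin n)) (p : Fin k) :
    Finset (Fin n) :=
  Finset.univ.filter fun x => x ∈ X p.succ \ X p.castSucc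

/-- The position of the block that contains `x` in an ordered partition `A` of `Fin n`. -/
noncomputable def blockIndex {k : ℕ} (A : Fin k → Finset (Fin n)) (x : Fin n) : ℕ :=
  sInf {p : ℕ | ∃ h : p < k, x ∈ A ⟨p, h⟩}

/-- The shuffle permutation of an ordered partition `A` of `Fin n`: it lists the elements of the
first block in increasing order, then those of the second block in increasing order, and so on.
(`Tuple.sort` is the stable sort, here with respect to the position of the block.) -/
noncomputable def shuffle {k : ℕ} (A : Fin k → Finset (Fin n)) : Equiv.Perm (Fin n) :=
  Tuple.sort (blockIndex A)

end Matroid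

section OS

variable (R : Type*) [CommRing R] {n : ℕ}

/-- The Orlik–Solomon ideal `I(M)`: the two-sided ideal of `E` generated by the `∂ e_S` for all
dependent sets `S` of `M`. -/
noncomputable def osIdeal (M : Matroid (Fin n)) : Ideal (Ext R n) :=
  TwoSidedIdeal.asIdeal
    (TwoSidedIdeal.span {a | ∃ S : Finset (Fin n), M.Dep (S : Set (Fin n)) ∧
      a = diff R n (mono R S)})

/-- `z(A) = sign(σ) ∂(e_{A_1}) ⋯ ∂(e_{A_k})` for an ordered partition `A = (A_1, …, A_k)` of
`Fin n`, with `σ` the shuffle of `A_1, …, A_k`. -/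
noncomputable def zPartition {k : ℕ} (A : Fin k → Finset (Fin n)) : Ext R n :=
  ((Equiv.Perm.sign (shuffle A) : ℤˣ) : ℤ) •
    (List.ofFn fun p : Fin k => diff R n (mono R (A p))).prod

/-- The element `z(T)`: the element `z` of the ordered partition given by the flag of `T`. -/
noncomputable def z (M : Matroid (Fin n)) (T : Finset (Fin n)) : Ext R n :=
  zPartition R (flagPartition (flag M T))

end OS

end OrlikSolomon

/-! The form `vol (a * b)`, reading off the top coefficient, is a nondegenerate pairing on E.
Straightening circuit relations rewrites every monomial modulo I as a combination of nbc-monomials,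
so an element a of I⁰ is determined by the values of `vol (a * mono R S)` for nbc-sets S
(`eq_zero_of_vol_mul_mono_nbc`).

Each z(T) lies in I⁰: ∂(e_A) is killed by e_i - e_j for i, j in A, and a dependent set always has
two elements in one block of the flag of T (`exists_ne_mem_flagPartition_of_dep`).

For the converse, extend each nbc-set S to an nbc-base T and put f_S = e_{T \ S} z(T). The matrix of
pairings of f_S with e_{S'} has diagonal entries ±1 and is triangular for `weight`
(`weight_lt_weight_of_mul_ne_zero`), because each element of T is the least element of its block.
Elimination, valid over any R, then writes every element of I⁰ through the f_S. Generators matter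
only up to sign, so signs are carried by `EqUpToSign` throughout. -/

namespace OrlikSolomon

/-! ### Equality up to sign. -/

section SignEquivalence

/-- Two elements of an additive group agree up to sign. -/
def EqUpToSign {A : Type*} [AddCommGroup A] (a b : A) : Prop :=
  ∃ u : ℤˣ, a = (u : ℤ) • b

namespace EqUpToSign

variable {A : Type*} [AddCommGroup A] {a b c : A}

theorem refl (a : A) : EqUpToSign a a := ⟨1, by simp⟩

theorem of_eq_neg (h : a = -b) : EqUpToSign a b := ⟨-1, by simp [h]⟩

theorem symm (h : EqUpToSign a b) : EqUpToSign b a := by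
  obtain ⟨u, rfl⟩ := h
  exact ⟨u, by rw [smul_smul, ← Units.val_mul, Int.units_mul_self, Units.val_one, one_smul]⟩

theorem trans (h : EqUpToSign a b) (h' : EqUpToSign b c) : EqUpToSign a c := by
  obtain ⟨u, rfl⟩ := h
  obtain ⟨v, rfl⟩ := h'
  exact ⟨u * v, by rw [smul_smul, Units.val_mul]⟩

theorem neg (h : EqUpToSign a b) : EqUpToSign (-a) b :=
  (of_eq_neg rfl).trans h

theorem mul {A : Type*} [Ring A] {a b c d : A} (h : EqUpToSign a b) (h' : EqUpToSign c d) :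
    EqUpToSign (a * c) (b * d) := by
  obtain ⟨u, rfl⟩ := h
  obtain ⟨v, rfl⟩ := h'
  exact ⟨u * v, by rw [smul_mul_assoc, mul_smul_comm, smul_smul, Units.val_mul]⟩

theorem map {B F : Type*} [AddCommGroup B] [FunLike F A B] [AddMonoidHomClass F A B] (f : F)
    (h : EqUpToSign a b) : EqUpToSign (f a) (f b) := by
  obtain ⟨u, rfl⟩ := h
  exact ⟨u, map_zsmul f _ _⟩

theorem eq_zero (h : EqUpToSign a b) (hb : b = 0) : a = 0 := by
  obtain ⟨u, rfl⟩ := h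
  rw [hb, smul_zero]

theorem mem_iff {S : Type*} [SetLike S A] [AddSubgroupClass S A] {s : S} (h : EqUpToSign a b) :
    a ∈ s ↔ b ∈ s := by
  have key : ∀ {x y : A}, EqUpToSign x y → y ∈ s → x ∈ s := by
    rintro x y ⟨u, rfl⟩ hy
    exact zsmul_mem hy _
  exact ⟨key h.symm, key h⟩

end EqUpToSign

end SignEquivalence

/-! ### Leibniz rule and parity in the exterior algebra. -/

section Calculus

variable {R : Type*} [CommRing R] {n : ℕ}

/-- The grade involution of `E`, which is `(-1) ^ p` in degree `p`. -/
noncomputable def invol : Ext R n →ₐ[R] Ext R n :=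
  CliffordAlgebra.involute (Q := (0 : QuadraticForm R (Fin n → R)))

theorem invol_ι (v : Fin n → R) : invol (ExteriorAlgebra.ι R v) = -ExteriorAlgebra.ι R v :=
  CliffordAlgebra.involute_ι (Q := (0 : QuadraticForm R (Fin n → R))) v

theorem invol_invol (a : Ext R n) : invol (invol a) = a :=
  CliffordAlgebra.involute_involute (Q := (0 : QuadraticForm R (Fin n → R))) a

theorem diff_ι_mul (v : Fin n → R) (b : Ext R n) :
    diff R n (ExteriorAlgebra.ι R v * b) = (∑ i, v i) • b - ExteriorAlgebra.ι R v * diff R n b := by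
  have h := CliffordAlgebra.contractLeft_ι_mul (Q := (0 : QuadraticForm R (Fin n → R)))
    (∑ j : Fin n, LinearMap.proj j : (Fin n → R) →ₗ[R] R) v b
  have h1 : (∑ j : Fin n, LinearMap.proj j : (Fin n → R) →ₗ[R] R) v = ∑ i, v i := by
    simp [LinearMap.sum_apply]
  rw [h1] at h
  exact h

theorem diff_ι (v : Fin n → R) : diff R n (ExteriorAlgebra.ι R v) = (∑ i, v i) • 1 := by
  have h := diff_ι_mul v (1 : Ext R n)
  rwa [mul_one, diff_one, mul_zero, sub_zero] at h

/-- The Leibniz rule. -/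
theorem diff_mul (a b : Ext R n) :
    diff R n (a * b) = diff R n a * b + invol a * diff R n b := by
  induction a using ExteriorAlgebra.induction generalizing b with
  | algebraMap r =>
    simp only [Algebra.algebraMap_eq_smul_one, smul_mul_assoc, one_mul, map_smul, diff_one,
      map_one, smul_zero, zero_mul, zero_add]
  | ι v =>
    rw [diff_ι_mul, diff_ι, invol_ι, smul_mul_assoc, one_mul, neg_mul, sub_eq_add_neg]
  | mul x y hx hy =>
    rw [mul_assoc, hx, hy, hx y, map_mul]
    simp only [mul_add, add_mul, mul_assoc, add_assoc]
  | add x y hx hy =>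
    simp only [add_mul, map_add, hx, hy]
    abel

theorem ι_anticomm (v w : Fin n → R) : ExteriorAlgebra.ι R v * ExteriorAlgebra.ι R w = -(ExteriorAlgebra.ι R w * ExteriorAlgebra.ι R v) :=
  eq_neg_of_add_eq_zero_left (ExteriorAlgebra.ι_add_mul_swap v w)

theorem mul_ι (a : Ext R n) (v : Fin n → R) : a * ExteriorAlgebra.ι R v = ExteriorAlgebra.ι R v * invol a := by
  induction a using ExteriorAlgebra.induction with
  | algebraMap r => rw [AlgHom.commutes]; exact Algebra.commutes r _
  | ι w => rw [invol_ι, mul_neg, ι_anticomm]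
  | mul x y hx hy => rw [mul_assoc, hy, ← mul_assoc, hx, map_mul, mul_assoc]
  | add x y hx hy => rw [add_mul, hx, hy, map_add, mul_add]

theorem invol_diff (a : Ext R n) : invol (diff R n a) = -diff R n (invol a) := by
  induction a using ExteriorAlgebra.induction with
  | algebraMap r =>
    simp only [Algebra.algebraMap_eq_smul_one, map_smul, diff_one, map_one, smul_zero, map_zero,
      neg_zero]
  | ι v => simp only [diff_ι, invol_ι, map_neg, map_smul, map_one, neg_neg]
  | mul x y hx hy =>
    rw [diff_mul, map_add, map_mul, map_mul, hx, hy, map_mul, diff_mul, invol_invol]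
    simp only [neg_mul, mul_neg, neg_add_rev]
    abel
  | add x y hx hy =>
    simp only [map_add, hx, hy, neg_add_rev]
    abel

theorem diff_diff (a : Ext R n) : diff R n (diff R n a) = 0 :=
  CliffordAlgebra.contractLeft_contractLeft (Q := (0 : QuadraticForm R (Fin n → R))) _ a

/-- An element is homogeneous in the parity grading if the grade involution fixes it up to sign. -/
def HasParity (a : Ext R n) : Prop := EqUpToSign (invol a) a

theorem hasParity_one : HasParity (1 : Ext R n) := by
  rw [HasParity, map_one]
  exact .refl _

theorem hasParity_ι (v : Fin n → R) : HasParity (ExteriorAlgebra.ι R v) :=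
  .of_eq_neg (invol_ι v)

theorem HasParity.mul {a b : Ext R n} (ha : HasParity a) (hb : HasParity b) :
    HasParity (a * b) := by
  rw [HasParity, map_mul]
  exact EqUpToSign.mul ha hb

theorem HasParity.diff {a : Ext R n} (ha : HasParity a) : HasParity (diff R n a) := by
  rw [HasParity, invol_diff]
  exact (EqUpToSign.map (OrlikSolomon.diff R n) ha).neg

theorem HasParity.list_prod {l : List (Ext R n)} (h : ∀ a ∈ l, HasParity a) :
    HasParity l.prod := by
  induction l with
  | nil => exact hasParity_one
  | cons a l ih =>
    rw [List.prod_cons]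
    exact (h a (by simp)).mul (ih fun b hb => h b (by simp [hb]))

theorem HasParity.mul_ι {a : Ext R n} (ha : HasParity a) (v : Fin n → R) :
    EqUpToSign (a * ExteriorAlgebra.ι R v) (ExteriorAlgebra.ι R v * a) := by
  rw [OrlikSolomon.mul_ι]
  exact EqUpToSign.mul (.refl _) ha

end Calculus

/-! ### Monomials and their products. -/

section Monomials

variable {R : Type*} [CommRing R] {n : ℕ}

variable (R) in
/-- The product of the generators indexed by the entries of a list. -/
noncomputable def genProd (l : List (Fin n)) : Ext R n := (l.map (gen R)).prod

theorem genProd_nil : genProd R ([] : List (Fin n)) = 1 := rfl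

theorem genProd_cons (i : Fin n) (l : List (Fin n)) :
    genProd R (i :: l) = gen R i * genProd R l := by
  simp [genProd]

theorem genProd_append (l l' : List (Fin n)) :
    genProd R (l ++ l') = genProd R l * genProd R l' := by
  simp [genProd]

theorem mono_eq_genProd (S : Finset (Fin n)) : mono R S = genProd R (S.sort (· ≤ ·)) := rfl

theorem hasParity_gen (i : Fin n) : HasParity (gen R i) := hasParity_ι _

theorem hasParity_genProd (l : List (Fin n)) : HasParity (genProd R l) := by
  refine HasParity.list_prod fun a ha => ?_
  obtain ⟨i, -, rfl⟩ := List.mem_map.1 ha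
  exact hasParity_gen i

theorem hasParity_mono (S : Finset (Fin n)) : HasParity (mono R S) := hasParity_genProd _

theorem gen_mul_self (i : Fin n) : gen R i * gen R i = 0 := ExteriorAlgebra.ι_sq_zero _

theorem genProd_perm {l l' : List (Fin n)} (h : l.Perm l') :
    EqUpToSign (genProd R l) (genProd R l') := by
  induction h with
  | nil => exact .refl _
  | cons i _ ih =>
    simp only [genProd_cons]
    exact EqUpToSign.mul (.refl _) ih
  | swap i j l =>
    simp only [genProd_cons, ← mul_assoc]
    exact EqUpToSign.mul (.of_eq_neg (ι_anticomm _ _)) (.refl _)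
  | trans _ _ ih ih' => exact ih.trans ih'

theorem gen_mul_genProd_of_mem {i : Fin n} {l : List (Fin n)} (h : i ∈ l) :
    gen R i * genProd R l = 0 := by
  refine (EqUpToSign.mul (.refl _) (genProd_perm (List.perm_cons_erase h))).eq_zero ?_
  rw [genProd_cons, ← mul_assoc, gen_mul_self, zero_mul]

theorem genProd_eq_zero {l : List (Fin n)} (h : ¬ l.Nodup) : genProd R l = 0 := by
  induction l with
  | nil => simp at h
  | cons i l ih =>
    rw [genProd_cons]
    by_cases hi : i ∈ l
    · exact gen_mul_genProd_of_mem hi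
    · rw [ih (by simpa [hi] using h), mul_zero]

theorem genProd_mono {l : List (Fin n)} (h : l.Nodup) {S : Finset (Fin n)}
    (hS : ∀ i, i ∈ l ↔ i ∈ S) : EqUpToSign (genProd R l) (mono R S) :=
  genProd_perm ((List.perm_ext_iff_of_nodup h (S.sort_nodup _)).2 fun i => by
    rw [hS, Finset.mem_sort])

theorem mono_mul_mono {S T : Finset (Fin n)} (h : Disjoint S T) :
    EqUpToSign (mono R S * mono R T) (mono R (S ∪ T)) := by
  rw [mono_eq_genProd, mono_eq_genProd, ← genProd_append]
  refine genProd_mono (List.Nodup.append (S.sort_nodup _) (T.sort_nodup _) ?_) (by simp)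
  intro i hi hi'
  exact Finset.disjoint_left.1 h ((Finset.mem_sort _).1 hi) ((Finset.mem_sort _).1 hi')

theorem mono_mul_mono_eq_zero {S T : Finset (Fin n)} (h : ¬ Disjoint S T) :
    mono R S * mono R T = 0 := by
  rw [mono_eq_genProd, mono_eq_genProd, ← genProd_append]
  refine genProd_eq_zero fun hn => h (Finset.disjoint_left.2 fun i hi hi' => ?_)
  exact List.disjoint_of_nodup_append hn ((Finset.mem_sort _).2 hi) ((Finset.mem_sort _).2 hi')

theorem gen_mul_mono {i : Fin n} {S : Finset (Fin n)} (h : i ∉ S) :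
    EqUpToSign (gen R i * mono R S) (mono R (insert i S)) := by
  rw [mono_eq_genProd, ← genProd_cons]
  exact genProd_mono (List.nodup_cons.2 ⟨by simpa using h, S.sort_nodup _⟩) (by simp)

theorem gen_mul_mono_of_mem {i : Fin n} {S : Finset (Fin n)} (h : i ∈ S) :
    gen R i * mono R S = 0 := gen_mul_genProd_of_mem ((Finset.mem_sort _).2 h)

theorem mono_mul_gen_of_mem {i : Fin n} {S : Finset (Fin n)} (h : i ∈ S) :
    mono R S * gen R i = 0 :=
  ((hasParity_mono S).mul_ι _).eq_zero (gen_mul_mono_of_mem h)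

theorem mono_erase {i : Fin n} {S : Finset (Fin n)} (h : i ∈ S) :
    EqUpToSign (mono R S) (gen R i * mono R (S.erase i)) := by
  have := gen_mul_mono (R := R) (Finset.notMem_erase i S)
  rw [Finset.insert_erase h] at this
  exact this.symm

/-- The derivative of `e_S` is a combination of the `e_{S \ i}`, `i ∈ S`. -/
theorem diff_mono_mem_span (S : Finset (Fin n)) :
    diff R n (mono R S) ∈ Submodule.span R ((fun i => mono R (S.erase i)) '' (S : Set (Fin n))) := by
  induction S using Finset.induction_on with
  | empty =>
    have : mono R (∅ : Finset (Fin n)) = 1 := by simp [mono]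
    rw [this, diff_one]
    exact zero_mem _
  | insert i S hi ih =>
    rw [(EqUpToSign.map (diff R n) (gen_mul_mono (R := R) hi)).symm.mem_iff, diff_gen_mul]
    refine sub_mem (Submodule.subset_span ⟨i, by simp, by simp [hi]⟩) ?_
    suffices h : ∀ y ∈ Submodule.span R ((fun j => mono R (S.erase j)) '' (S : Set (Fin n))),
        gen R i * y ∈ Submodule.span R
          ((fun j => mono R ((insert i S).erase j)) '' ((insert i S : Finset (Fin n)) : Set (Fin n)))
      from h _ ih
    intro y hy
    induction hy using Submodule.span_induction with
    | mem y hy =>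
      obtain ⟨j, hj, rfl⟩ := hy
      have hij : i ≠ j := fun h => hi (h ▸ hj)
      refine ((gen_mul_mono (R := R) (i := i) (S := S.erase j) (by simp [hi])).mem_iff).2
        (Submodule.subset_span ⟨j, by simpa using Or.inr hj, ?_⟩)
      simp only [Finset.erase_insert_of_ne hij]
    | zero => rw [mul_zero]; exact zero_mem _
    | add x y _ _ hx hy => rw [mul_add]; exact add_mem hx hy
    | smul r x _ hx => rw [mul_smul_comm]; exact Submodule.smul_mem _ _ hx

theorem ι_eq_sum (v : Fin n → R) : ExteriorAlgebra.ι R v = ∑ i, v i • gen R i := by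
  conv_lhs => rw [← Finset.univ_sum_single v]
  rw [map_sum]
  refine Finset.sum_congr rfl fun i _ => ?_
  rw [gen, ← map_smul, ← Pi.single_smul, smul_eq_mul, mul_one]

/-- The span is stable under left multiplication by generators, hence a left ideal, and it contains
1. -/
theorem span_mono : Submodule.span R (Set.range (mono R (n := n))) = ⊤ := by
  set W := Submodule.span R (Set.range (mono R (n := n)))
  have hgen : ∀ (i : Fin n), ∀ y ∈ W, gen R i * y ∈ W := by
    intro i y hy
    induction hy using Submodule.span_induction with
    | mem y hy =>
      obtain ⟨S, rfl⟩ := hy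
      by_cases h : i ∈ S
      · rw [gen_mul_mono_of_mem h]; exact zero_mem _
      · exact (gen_mul_mono h).mem_iff.2 (Submodule.subset_span ⟨_, rfl⟩)
    | zero => rw [mul_zero]; exact zero_mem _
    | add x y _ _ hx hy => rw [mul_add]; exact add_mem hx hy
    | smul r x _ hx => rw [mul_smul_comm]; exact Submodule.smul_mem _ _ hx
  have hall : ∀ a : Ext R n, ∀ y ∈ W, a * y ∈ W := by
    intro a
    induction a using ExteriorAlgebra.induction with
    | algebraMap r =>
      intro y hy
      rw [Algebra.algebraMap_eq_smul_one, smul_mul_assoc, one_mul]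
      exact Submodule.smul_mem _ _ hy
    | ι v =>
      intro y hy
      rw [ι_eq_sum, Finset.sum_mul]
      refine sum_mem fun i _ => ?_
      rw [smul_mul_assoc]
      exact Submodule.smul_mem _ _ (hgen i y hy)
    | mul x y hx hy => intro w hw; rw [mul_assoc]; exact hx _ (hy _ hw)
    | add x y hx hy => intro w hw; rw [add_mul]; exact add_mem (hx _ hw) (hy _ hw)
  refine eq_top_iff.2 fun a _ => ?_
  have h1 : (1 : Ext R n) ∈ W := Submodule.subset_span ⟨∅, by simp [mono]⟩
  simpa using hall a 1 h1

end Monomials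

/-! ### The top-degree pairing. -/

section Volume

variable {R : Type*} [CommRing R] {n : ℕ}

variable (R n) in
/-- The linear form on `E` that reads off the coefficient of the top monomial. -/
noncomputable def vol : Ext R n →ₗ[R] R :=
  ExteriorAlgebra.liftAlternating
    (Pi.single n (Matrix.detRowAlternating (n := Fin n) (R := R)))

theorem vol_mono_univ : vol R n (mono R Finset.univ) = 1 := by
  have h : mono R (Finset.univ : Finset (Fin n)) =
      ExteriorAlgebra.ιMulti R n (fun i => Pi.single i (1 : R)) := by
    rw [ExteriorAlgebra.ιMulti_apply, mono, Fin.sort_univ, List.ofFn_eq_map]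
    rfl
  rw [h, vol, ExteriorAlgebra.liftAlternating_apply_ιMulti, Pi.single_eq_same]
  have : (fun i => Pi.single i (1 : R) : Fin n → Fin n → R) = (1 : Matrix (Fin n) (Fin n) R) := by
    ext i j
    rw [Matrix.one_apply, Pi.single_apply]
    simp only [eq_comm]
  rw [this]
  exact Matrix.det_one

/-- The pairing `(a, b) ↦ vol (a b)` is nondegenerate. -/
theorem eq_zero_of_vol_mul_mono {a : Ext R n} (h : ∀ S, vol R n (a * mono R S) = 0) : a = 0 := by
  have ha : a ∈ Submodule.span R (Set.range (mono R (n := n))) := by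
    rw [span_mono]; trivial
  obtain ⟨c, rfl⟩ := (Submodule.mem_span_range_iff_exists_fun R).1 ha
  -- Multiplying by the monomial of the complement of S kills every term not supported inside S;
  -- proper subsets have coefficient zero by induction, so only ±c S remains.
  have hc : ∀ S, c S = 0 := by
    intro S
    induction S using Finset.strongInduction with
    | H S ih =>
      have hS := h Sᶜ
      rw [Finset.sum_mul, Finset.sum_eq_single S] at hS
      · obtain ⟨u, hu⟩ := mono_mul_mono (R := R) (disjoint_compl_right : Disjoint S Sᶜ)
        rw [smul_mul_assoc, hu, Finset.union_compl, map_smul, map_zsmul, vol_mono_univ,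
          smul_comm, smul_eq_mul, mul_one] at hS
        exact (EqUpToSign.symm ⟨u, rfl⟩ : EqUpToSign (c S) ((u : ℤ) • c S)).eq_zero hS
      · intro T _ hT
        rw [smul_mul_assoc]
        by_cases hTS : T ⊆ S
        · rw [ih T (lt_of_le_of_ne hTS hT), zero_smul]
        · rw [mono_mul_mono_eq_zero fun hd => hTS (disjoint_compl_right_iff.1 hd), smul_zero]
      · simp
  exact Finset.sum_eq_zero fun S _ => by rw [hc S, zero_smul]

end Volume

end OrlikSolomon

namespace OrlikSolomon

/-! ### Products of the derivatives of the blocks of an ordered partition. -/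

section Blocks

variable {R : Type*} [CommRing R] {n k : ℕ}

variable (R) in
/-- The product `∂(e_{A_1}) ⋯ ∂(e_{A_k})`. -/
noncomputable def blockProd (A : Fin k → Finset (Fin n)) : Ext R n :=
  (List.ofFn fun p : Fin k => diff R n (mono R (A p))).prod

theorem zPartition_eqUpToSign (A : Fin k → Finset (Fin n)) :
    EqUpToSign (zPartition R A) (blockProd R A) := ⟨_, rfl⟩

theorem hasParity_blockProd (A : Fin k → Finset (Fin n)) : HasParity (blockProd R A) := by
  refine HasParity.list_prod fun a ha => ?_
  obtain ⟨p, rfl⟩ := (List.mem_ofFn' _ _).1 ha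
  exact (hasParity_mono _).diff

theorem diff_list_prod_eq_zero {l : List (Ext R n)} (h : ∀ a ∈ l, diff R n a = 0) :
    diff R n l.prod = 0 := by
  induction l with
  | nil => exact diff_one
  | cons a l ih =>
    rw [List.prod_cons, diff_mul, h a (by simp), ih fun b hb => h b (by simp [hb]), zero_mul,
      mul_zero, zero_add]

theorem diff_blockProd (A : Fin k → Finset (Fin n)) : diff R n (blockProd R A) = 0 := by
  refine diff_list_prod_eq_zero fun a ha => ?_
  obtain ⟨p, rfl⟩ := (List.mem_ofFn' _ _).1 ha
  exact diff_diff _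

/-- Up to sign, the vector moves left past the later factors until it meets the one it kills. -/
theorem list_prod_mul_ι_eq_zero {l : List (Ext R n)} (h : ∀ a ∈ l, HasParity a)
    {v : Fin n → R} {b : Ext R n} (hb : b ∈ l) (hbv : b * ExteriorAlgebra.ι R v = 0) :
    l.prod * ExteriorAlgebra.ι R v = 0 := by
  induction l with
  | nil => simp at hb
  | cons a l ih =>
    rw [List.prod_cons, mul_assoc]
    have h' : ∀ a ∈ l, HasParity a := fun c hc => h c (by simp [hc])
    rcases List.mem_cons.1 hb with rfl | hb
    · refine (EqUpToSign.mul (.refl b) ((HasParity.list_prod h').mul_ι v)).eq_zero ?_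
      rw [← mul_assoc, hbv, zero_mul]
    · rw [ih h' hb, mul_zero]

/-- Differentiate e_S e_i = 0. -/
theorem diff_mono_mul_gen {i : Fin n} {S : Finset (Fin n)} (hi : i ∈ S) :
    EqUpToSign (diff R n (mono R S) * gen R i) (mono R S) := by
  have h := congrArg (diff R n) (mono_mul_gen_of_mem (R := R) hi)
  rw [diff_mul, diff_gen, mul_one, map_zero] at h
  exact (EqUpToSign.of_eq_neg (eq_neg_of_add_eq_zero_left h)).trans (hasParity_mono S)

theorem ι_single_sub_single (i j : Fin n) :
    ExteriorAlgebra.ι R (Pi.single i (1 : R) - Pi.single j 1) = gen R i - gen R j :=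
  map_sub _ _ _

/-- Differentiate e_S (e_i - e_j) = 0, where e_i - e_j has derivative zero. -/
theorem diff_mono_mul_sub {i j : Fin n} {S : Finset (Fin n)} (hi : i ∈ S) (hj : j ∈ S) :
    diff R n (mono R S) * (gen R i - gen R j) = 0 := by
  have h : mono R S * (gen R i - gen R j) = 0 := by
    rw [mul_sub, mono_mul_gen_of_mem hi, mono_mul_gen_of_mem hj, sub_zero]
  have h' := congrArg (diff R n) h
  rwa [diff_mul, map_sub, diff_gen, diff_gen, sub_self, mul_zero, add_zero, map_zero] at h'

theorem blockProd_mul_sub {A : Fin k → Finset (Fin n)} {p : Fin k} {i j : Fin n}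
    (hi : i ∈ A p) (hj : j ∈ A p) : blockProd R A * (gen R i - gen R j) = 0 := by
  rw [← ι_single_sub_single]
  refine list_prod_mul_ι_eq_zero (fun a ha => ?_) ((List.mem_ofFn' _ _).2 ⟨p, rfl⟩) ?_
  · obtain ⟨q, rfl⟩ := (List.mem_ofFn' _ _).1 ha
    exact (hasParity_mono _).diff
  · rw [ι_single_sub_single]
    exact diff_mono_mul_sub hi hj

/-- The product `∂(e_{A_1}) ⋯ ∂(e_{A_k})` annihilates every monomial with two factors from the same
block. -/
theorem blockProd_mul_mul_mono {A : Fin k → Finset (Fin n)} {p : Fin k} {i j : Fin n}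
    (hi : i ∈ A p) (hj : j ∈ A p) (hij : i ≠ j) {S : Finset (Fin n)} (hiS : i ∈ S) (hjS : j ∈ S)
    (x : Ext R n) : blockProd R A * x * mono R S = 0 := by
  -- Since e_j² = 0, the factor e_i of e_S may be replaced by e_i - e_j.
  have h1 : EqUpToSign (mono R S)
      ((gen R i - gen R j) * (gen R j * mono R ((S.erase i).erase j))) := by
    rw [sub_mul, ← mul_assoc (gen R j), gen_mul_self, zero_mul, sub_zero]
    exact (mono_erase hiS).trans
      (EqUpToSign.mul (.refl _) (mono_erase (Finset.mem_erase.2 ⟨hij.symm, hjS⟩)))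
  refine (EqUpToSign.mul (.refl (blockProd R A * x)) h1).eq_zero ?_
  rw [mul_assoc, ← mul_assoc x, ← ι_single_sub_single, mul_ι, ι_single_sub_single, mul_assoc,
    ← mul_assoc (blockProd R A), blockProd_mul_sub hi hj, zero_mul]

theorem blockProd_mul_mono {A : Fin k → Finset (Fin n)} {p : Fin k} {i j : Fin n}
    (hi : i ∈ A p) (hj : j ∈ A p) (hij : i ≠ j) {S : Finset (Fin n)} (hiS : i ∈ S)
    (hjS : j ∈ S) : blockProd R A * mono R S = 0 := by
  simpa using blockProd_mul_mul_mono (R := R) hi hj hij hiS hjS 1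

/-- Differentiate the preceding vanishing. The block product has derivative zero, and the term in
which ∂ hits the middle factor vanishes by the same result, so the term with ∂(e_S) vanishes too. -/
theorem blockProd_mul_mul_diff_mono {A : Fin k → Finset (Fin n)} {p : Fin k} {i j : Fin n}
    (hi : i ∈ A p) (hj : j ∈ A p) (hij : i ≠ j) {S : Finset (Fin n)} (hiS : i ∈ S) (hjS : j ∈ S)
    (x : Ext R n) : blockProd R A * x * diff R n (mono R S) = 0 := by
  -- The Leibniz rule applies `invol` to the middle factor; starting from `invol x` makes it come
  -- out as x.
  have h := congrArg (diff R n) (blockProd_mul_mul_mono (R := R) hi hj hij hiS hjS (invol x))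
  rw [diff_mul, diff_mul, diff_blockProd, zero_mul, zero_add, map_zero, map_mul, invol_invol] at h
  have h2 : invol (blockProd R A) * diff R n (invol x) * mono R S = 0 := by
    refine (EqUpToSign.mul (EqUpToSign.mul (hasParity_blockProd A) (.refl _)) (.refl _)).eq_zero ?_
    exact blockProd_mul_mul_mono hi hj hij hiS hjS _
  rw [h2, zero_add] at h
  exact (EqUpToSign.mul (EqUpToSign.mul (hasParity_blockProd A).symm (.refl _)) (.refl _)).eq_zero h

/-- Each e_{t p} moves left past the derivatives of the later blocks to that of its own block, where
it restores the full monomial. -/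
theorem prod_diff_mono_mul_genProd {ι : Type*} (A : ι → Finset (Fin n)) (t : ι → Fin n)
    (ht : ∀ p, t p ∈ A p) (l : List ι) :
    EqUpToSign ((l.map fun p => diff R n (mono R (A p))).prod * genProd R (l.map t))
      (genProd R (l.flatMap fun p => (A p).sort (· ≤ ·))) := by
  induction l with
  | nil =>
    simp only [List.map_nil, List.prod_nil, List.flatMap_nil, genProd_nil, mul_one]
    exact .refl _
  | cons p l ih =>
    rw [List.map_cons, List.prod_cons, List.map_cons, genProd_cons, List.flatMap_cons,
      genProd_append, mul_assoc, ← mul_assoc _ (gen R (t p))]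
    have hpar : HasParity (l.map fun p => diff R n (mono R (A p))).prod := by
      refine HasParity.list_prod fun a ha => ?_
      obtain ⟨q, -, rfl⟩ := List.mem_map.1 ha
      exact (hasParity_mono _).diff
    refine (EqUpToSign.mul (.refl _) (EqUpToSign.mul (hpar.mul_ι _) (.refl _))).trans ?_
    rw [mul_assoc, ← mul_assoc]
    exact EqUpToSign.mul (diff_mono_mul_gen (ht p)) ih

/-- The product `∂(e_{A_1}) ⋯ ∂(e_{A_k})` of an ordered partition pairs to `±1` with the monomial
of a transversal. -/
theorem blockProd_mul_mono_transversal {A : Fin k → Finset (Fin n)}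
    (hdisj : ∀ p q, p ≠ q → Disjoint (A p) (A q)) (hcover : ∀ x, ∃ p, x ∈ A p)
    {t : Fin k → Fin n} (ht : ∀ p, t p ∈ A p) {T : Finset (Fin n)}
    (hT : ∀ x, x ∈ T ↔ ∃ p, t p = x) :
    EqUpToSign (blockProd R A * mono R T) (mono R Finset.univ) := by
  have hinj : Function.Injective t := by
    intro p q hpq
    by_contra hne
    exact Finset.disjoint_left.1 (hdisj p q hne) (ht p) (hpq ▸ ht q)
  have h1 : EqUpToSign (genProd R ((List.finRange k).map t)) (mono R T) :=
    genProd_mono ((List.nodup_finRange k).map hinj) (by simp [hT])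
  have h2 : EqUpToSign (genProd R ((List.finRange k).flatMap fun p => (A p).sort (· ≤ ·)))
      (mono R Finset.univ) := by
    refine genProd_mono (List.nodup_flatMap.2 ⟨fun p _ => (A p).sort_nodup _, ?_⟩)
      (by simpa using hcover)
    refine (List.nodup_finRange k).imp fun {p q} hpq x hx hx' => ?_
    exact Finset.disjoint_left.1 (hdisj p q hpq) ((Finset.mem_sort _).1 hx)
      ((Finset.mem_sort _).1 hx')
  refine (EqUpToSign.mul (.refl _) h1.symm).trans ?_
  rw [blockProd, List.ofFn_eq_map]
  exact (prod_diff_mono_mul_genProd A t ht _).trans h2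

/-- The derivative of a nonempty monomial is a product of differences of generators. -/
theorem diff_genProd_cons (a : Fin n) (l : List (Fin n)) :
    diff R n (genProd R (a :: l)) =
      ((l.map fun x => (Pi.single x (1 : R) - Pi.single a 1 : Fin n → R)).map
        (ExteriorAlgebra.ι R)).prod := by
  rw [List.map_map]
  -- Because e_a² = 0, every later e_x may be replaced by e_x - e_a, which has derivative zero; then
  -- ∂ only removes the leading e_a.
  have h : genProd R (a :: l) =
      gen R a * (l.map (ExteriorAlgebra.ι R ∘
        fun x => (Pi.single x (1 : R) - Pi.single a 1 : Fin n → R))).prod := by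
    rw [genProd_cons]
    induction l with
    | nil => rfl
    | cons x l ih =>
      have hx : gen R a * (gen R x - gen R a) = -(gen R x * gen R a) + 0 := by
        rw [mul_sub, gen_mul_self, sub_zero, add_zero]
        exact ι_anticomm _ _
      rw [genProd_cons, List.map_cons, List.prod_cons, Function.comp_apply, ι_single_sub_single,
        ← mul_assoc (gen R a) (_ - _), hx, add_zero, neg_mul, mul_assoc (gen R x), ← ih,
        ← mul_assoc, ← mul_assoc, ← neg_mul]
      congr 1
      exact ι_anticomm _ _
  rw [h, diff_gen_mul, diff_list_prod_eq_zero, mul_zero, sub_zero]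
  intro b hb
  obtain ⟨x, -, rfl⟩ := List.mem_map.1 hb
  rw [Function.comp_apply, ι_single_sub_single, map_sub, diff_gen, diff_gen, sub_self]

theorem isPure_one : IsPure R (1 : Ext R n) := ⟨[], rfl⟩

theorem IsPure.mul {a b : Ext R n} (ha : IsPure R a) (hb : IsPure R b) : IsPure R (a * b) := by
  obtain ⟨l, rfl⟩ := ha
  obtain ⟨l', rfl⟩ := hb
  exact ⟨l ++ l', by simp⟩

theorem isPure_diff_mono {S : Finset (Fin n)} (hS : S.Nonempty) :
    IsPure R (diff R n (mono R S)) := by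
  rw [mono_eq_genProd]
  match h : S.sort (· ≤ ·) with
  | [] =>
    obtain ⟨x, hx⟩ := hS
    rw [← Finset.mem_sort (· ≤ ·), h] at hx
    simp at hx
  | a :: l => exact ⟨_, diff_genProd_cons a l⟩

theorem isPure_blockProd {A : Fin k → Finset (Fin n)} (hA : ∀ p, (A p).Nonempty) :
    IsPure R (blockProd R A) := by
  have h : ∀ l : List (Ext R n), (∀ a ∈ l, IsPure R a) → IsPure R l.prod := by
    intro l hl
    induction l with
    | nil => exact isPure_one
    | cons a l ih =>
      rw [List.prod_cons]
      exact (hl a (by simp)).mul (ih fun b hb => hl b (by simp [hb]))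
  refine h _ fun a ha => ?_
  obtain ⟨p, rfl⟩ := (List.mem_ofFn' _ _).1 ha
  exact isPure_diff_mono (hA p)

end Blocks

end OrlikSolomon

namespace OrlikSolomon

/-! ### Ordered partitions from chains of sets. -/

section Chains

variable {α : Type*} {k : ℕ} {X : Fin (k + 1) → Set α}

theorem exists_mem_succ_sdiff_castSucc (h0 : X 0 = ∅) (h1 : X (Fin.last k) = Set.univ) (x : α) :
    ∃ p : Fin k, x ∈ X p.succ \ X p.castSucc := by
  by_contra! h
  have hx : ∀ p, x ∉ X p := by
    intro p
    induction p using Fin.induction with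
    | zero => simp [h0]
    | succ p ih => exact fun hp => h p ⟨hp, ih⟩
  exact hx (Fin.last k) (by simp [h1])

theorem mem_flagPartition {n : ℕ} {X : Fin (k + 1) → Set (Fin n)} {p : Fin k} {x : Fin n} :
    x ∈ flagPartition X p ↔ x ∈ X p.succ ∧ x ∉ X p.castSucc := by
  simp [flagPartition]

theorem disjoint_flagPartition {n : ℕ} {X : Fin (k + 1) → Set (Fin n)} (hX : Monotone X)
    {p q : Fin k} (h : p ≠ q) : Disjoint (flagPartition X p) (flagPartition X q) := by
  have key : ∀ {p q : Fin k}, p < q → ∀ x, x ∈ flagPartition X p → x ∉ flagPartition X q := by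
    intro p q hpq x hp hq
    rw [mem_flagPartition] at hp hq
    exact hq.2 (hX (Fin.succ_le_castSucc_iff.2 hpq) hp.1)
  refine Finset.disjoint_left.2 fun x hp hq => ?_
  rcases lt_or_gt_of_ne h with h | h
  · exact key h x hp hq
  · exact key h x hq hp

end Chains

/-! ### Nbc-sets, nbc-bases and their flags. -/

section Nbc

variable {n : ℕ} {M : Matroid (Fin n)}

theorem exists_isLeast_of_isCircuit {C : Set (Fin n)} (hC : M.IsCircuit C) :
    ∃ x, IsLeast C x := by
  obtain ⟨x, hx, hmin⟩ := Set.exists_min_image C id C.toFinite hC.nonempty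
  exact ⟨x, hx, hmin⟩

theorem IsNbc.indep (hE : M.E = Set.univ) {S : Finset (Fin n)} (hS : IsNbc M S) :
    M.Indep (S : Set (Fin n)) := by
  by_contra h
  obtain ⟨C, hCS, hC⟩ := ((M.not_indep_iff (by simp [hE])).1 h).exists_isCircuit_subset
  obtain ⟨x, hx⟩ := exists_isLeast_of_isCircuit hC
  exact hS _ ⟨C, x, hC, hx, rfl⟩ (Set.sdiff_subset.trans hCS)

theorem IsNbcBase.isBase (hE : M.E = Set.univ) {T : Finset (Fin n)} (hT : IsNbcBase M T) :
    M.IsBase (T : Set (Fin n)) := by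
  have hI := hT.1.indep hE
  refine hI.isBase_of_eRk_ge T.finite_toSet ?_
  rw [hI.eRk_eq_encard, Set.encard_coe_eq_coe_finsetCard, hT.2]

/-- Every set without broken circuits is contained in one that is a base. -/
theorem IsNbc.exists_isNbcBase_superset (hE : M.E = Set.univ) {S : Finset (Fin n)}
    (hS : IsNbc M S) : ∃ T, IsNbcBase M T ∧ S ⊆ T := by
  classical
  let F : Finset (Finset (Fin n)) :=
    Finset.univ.filter fun T => M.IsBase (T : Set (Fin n)) ∧ S ⊆ T
  have hF : F.Nonempty := by
    obtain ⟨B, hB, hSB⟩ := (hS.indep hE).exists_isBase_superset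
    refine ⟨B.toFinset, ?_⟩
    simp only [F, Finset.mem_filter, Finset.mem_univ, true_and, Set.coe_toFinset]
    exact ⟨hB, fun x hx => by simpa using hSB hx⟩
  -- Among the bases containing S take one of least index sum: a broken circuit inside it would
  -- allow an exchange for the smaller deleted element.
  obtain ⟨T, hTF, hmin⟩ := F.exists_min_image (fun T => ∑ i ∈ T, (i : ℕ)) hF
  simp only [F, Finset.mem_filter, Finset.mem_univ, true_and] at hTF hmin
  obtain ⟨hT, hST⟩ := hTF
  refine ⟨T, ⟨?_, ?_⟩, hST⟩
  · rintro _ ⟨C, x, hC, hx, rfl⟩ hCT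
    have hxT : x ∉ T := fun h => hC.not_indep (hT.indep.subset fun y hy => by
      by_cases hyx : y = x
      · exact hyx ▸ h
      · exact hCT ⟨hy, hyx⟩)
    have hCi : C ⊆ insert x (T : Set (Fin n)) := fun y hy => by
      by_cases hyx : y = x
      · exact Or.inl hyx
      · exact Or.inr (hCT ⟨hy, hyx⟩)
    -- As S is nbc, the broken circuit leaves S; exchanging such a y preserves S.
    obtain ⟨y, ⟨hyC, hyx⟩, hyS⟩ : ∃ y ∈ C \ {x}, y ∉ S := by
      by_contra! h
      exact hS _ ⟨C, x, hC, hx, rfl⟩ h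
    have hyT : y ∈ T := hCT ⟨hyC, hyx⟩
    have hxy : x < y := lt_of_le_of_ne (hx.2 hyC) (Ne.symm hyx)
    -- C is the fundamental circuit of x in T, so deleting any of its elements restores
    -- independence.
    have hind : M.Indep (insert x (T : Set (Fin n)) \ {y}) := by
      refine (hT.indep.mem_fundCircuit_iff ?_ (by simpa using hxT)).1 ?_
      · rw [hT.closure_eq, hE]; trivial
      · rwa [← hC.eq_fundCircuit_of_subset hT.indep hCi]
    have hset : ((insert x (T.erase y) : Finset (Fin n)) : Set (Fin n)) =
        insert x ((T : Set (Fin n)) \ {y}) := by simp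
    have hle := hmin (insert x (T.erase y)) ⟨by
      rw [hset]
      refine hT.exchange_isBase_of_indep (by simpa using hxT) ?_
      rwa [Set.insert_sdiff_singleton_comm hxy.ne], fun s hs => by
        have : s ≠ y := fun h => hyS (h ▸ hs)
        simp [this, hST hs]⟩
    rw [Finset.sum_insert (by simp [hxT]), ← Finset.add_sum_erase _ _ hyT] at hle
    have : (x : ℕ) < y := hxy
    omega
  · rw [← hT.encard_eq_eRank, Set.encard_coe_eq_coe_finsetCard]

/-- The elements of a finite set in decreasing order. -/
noncomputable def decreasingEnum (T : Finset (Fin n)) (p : Fin T.card) : Fin n :=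
  T.orderEmbOfFin rfl p.rev

theorem decreasingEnum_strictAnti (T : Finset (Fin n)) : StrictAnti (decreasingEnum T) :=
  fun _ _ h => (T.orderEmbOfFin rfl).strictMono (Fin.rev_lt_rev.2 h)

theorem exists_decreasingEnum_eq {T : Finset (Fin n)} {x : Fin n} :
    (∃ p, decreasingEnum T p = x) ↔ x ∈ T := by
  rw [← Finset.mem_coe, ← T.range_orderEmbOfFin rfl]
  exact ⟨fun ⟨p, hp⟩ => ⟨p.rev, hp⟩, fun ⟨p, hp⟩ => ⟨p.rev, by simpa [decreasingEnum] using hp⟩⟩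

theorem flag_eq_closure (M : Matroid (Fin n)) (T : Finset (Fin n)) (p : Fin (T.card + 1)) :
    flag M T p = M.closure (decreasingEnum T '' {q | q.castSucc < p}) := by
  rw [flag]
  congr 1
  ext x
  simp only [Set.mem_ofPred_eq, List.mem_drop_iff_getElem, Finset.length_sort, Set.mem_image,
    decreasingEnum]
  have hp := p.is_lt
  constructor
  · rintro ⟨j, hj, rfl⟩
    refine ⟨⟨T.card - 1 - (T.card - p + j), by omega⟩, ?_, ?_⟩
    · rw [Fin.lt_def, Fin.val_castSucc]
      dsimp only
      omega
    · rw [Finset.orderEmbOfFin_apply, Fin.getElem_fin]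
      refine getElem_congr_idx ?_
      rw [Fin.val_rev]
      dsimp only
      omega
  · rintro ⟨q, hq, rfl⟩
    rw [Fin.lt_def, Fin.val_castSucc] at hq
    have hq' := q.is_lt
    refine ⟨p - 1 - q, by omega, ?_⟩
    rw [Finset.orderEmbOfFin_apply, Fin.getElem_fin]
    exact getElem_congr_idx (by rw [Fin.val_rev]; omega)

theorem flag_monotone (M : Matroid (Fin n)) (T : Finset (Fin n)) : Monotone (flag M T) := by
  intro p q h
  rw [flag_eq_closure, flag_eq_closure]
  exact M.closure_subset_closure (Set.image_mono fun r hr => lt_of_lt_of_le hr h)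

/-- The closure of the empty set consists of the loops, excluded by the case x = y of simplicity. -/
theorem flag_zero (hE : M.E = Set.univ) (hM : IsSimple M) (T : Finset (Fin n)) :
    flag M T 0 = ∅ := by
  rw [flag_eq_closure]
  simp only [Fin.not_lt_zero, Set.ofPred_false, Set.image_empty]
  refine Set.eq_empty_iff_forall_notMem.2 fun x hx => ?_
  have hind := hM x (by simp [hE]) x (by simp [hE])
  rw [Set.pair_eq_singleton] at hind
  exact (Matroid.IsLoop.dep (M := M) hx).not_indep hind

theorem flag_last (hE : M.E = Set.univ) {T : Finset (Fin n)} (hT : IsNbcBase M T) :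
    flag M T (Fin.last T.card) = Set.univ := by
  have h : decreasingEnum T '' {q | q.castSucc < Fin.last T.card} = T := by
    ext x
    simp only [Fin.castSucc_lt_last, Set.ofPred_true, Set.image_univ, Set.mem_range,
      Finset.mem_coe]
    exact exists_decreasingEnum_eq
  rw [flag_eq_closure, h, (hT.isBase hE).closure_eq, hE]

theorem exists_mem_flagPartition_flag (hE : M.E = Set.univ) (hM : IsSimple M)
    {T : Finset (Fin n)} (hT : IsNbcBase M T) (x : Fin n) :
    ∃ p, x ∈ flagPartition (flag M T) p := by
  simp only [mem_flagPartition]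
  exact exists_mem_succ_sdiff_castSucc (flag_zero hE hM T) (flag_last hE hT) x

theorem decreasingEnum_mem_flagPartition (hE : M.E = Set.univ) {T : Finset (Fin n)}
    (hT : IsNbc M T) (p : Fin T.card) : decreasingEnum T p ∈ flagPartition (flag M T) p := by
  rw [mem_flagPartition, flag_eq_closure, flag_eq_closure]
  refine ⟨M.mem_closure_of_mem' ⟨p, Fin.castSucc_lt_succ, rfl⟩ (by simp [hE]), fun h => ?_⟩
  refine (hT.indep hE).notMem_closure_sdiff_of_mem
    (exists_decreasingEnum_eq.1 ⟨p, rfl⟩) (M.closure_subset_closure ?_ h)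
  rintro _ ⟨q, hq, rfl⟩
  refine ⟨exists_decreasingEnum_eq.1 ⟨q, rfl⟩, fun h => ?_⟩
  rw [Set.mem_singleton_iff, (decreasingEnum_strictAnti T).injective.eq_iff] at h
  subst h
  exact lt_irrefl q.castSucc hq

/-- The `p`-th element of `T`, counted from the top, is the smallest of its block. -/
theorem decreasingEnum_le_of_mem_flagPartition {T : Finset (Fin n)}
    (hT : IsNbc M T) {p : Fin T.card} {x : Fin n} (hx : x ∈ flagPartition (flag M T) p) :
    decreasingEnum T p ≤ x := by
  by_contra! h
  have hcl := (mem_flagPartition.1 hx).1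
  rw [flag_eq_closure] at hcl
  have hle : ∀ y ∈ decreasingEnum T '' {q | q.castSucc < p.succ}, x < y := by
    rintro _ ⟨q, hq, rfl⟩
    exact h.trans_le ((decreasingEnum_strictAnti T).antitone (Fin.castSucc_lt_succ_iff.1 hq))
  -- A smaller x in this flat would be the least element of a circuit whose other elements all lie
  -- in T, so T would contain a broken circuit.
  obtain ⟨C, hCs, hC, hxC⟩ :=
    M.exists_isCircuit_of_mem_closure hcl (fun hx' => lt_irrefl _ (hle x hx'))
  refine hT _ ⟨C, x, hC, ⟨hxC, fun y hy => ?_⟩, rfl⟩ fun y hy => ?_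
  · rcases hCs hy with rfl | hy
    · exact le_rfl
    · exact (hle y hy).le
  · rcases hCs hy.1 with h' | ⟨q, -, rfl⟩
    · exact absurd h' hy.2
    · exact exists_decreasingEnum_eq.1 ⟨q, rfl⟩

/-- A dependent set has two elements in the same block of the partition given by a flag. -/
theorem exists_ne_mem_flagPartition_of_dep (hE : M.E = Set.univ) (hM : IsSimple M)
    {T : Finset (Fin n)} (hT : IsNbcBase M T) {S : Finset (Fin n)}
    (hS : M.Dep (S : Set (Fin n))) :
    ∃ p, ∃ i ∈ S, ∃ j ∈ S, i ≠ j ∧ i ∈ flagPartition (flag M T) p ∧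
      j ∈ flagPartition (flag M T) p := by
  by_contra! hcon
  choose β hβ using exists_mem_flagPartition_flag hE hM hT
  obtain ⟨C, hCS, hC⟩ := hS.exists_isCircuit_subset
  -- Let x lie in the last block met by a circuit C. If no block is met twice, the rest of C lies in
  -- the preceding flat, which then contains x.
  obtain ⟨x, hxC, hmax⟩ := Set.exists_max_image C β C.toFinite hC.nonempty
  have hsub : C \ {x} ⊆ flag M T (β x).castSucc := by
    rintro y ⟨hy, hyx⟩
    have hne : β y ≠ β x := fun h => hcon (β x) y (hCS hy) x (hCS hxC) hyx (h ▸ hβ y) (hβ x)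
    exact flag_monotone M T (Fin.succ_le_castSucc_iff.2 (lt_of_le_of_ne (hmax y hy) hne))
      (mem_flagPartition.1 (hβ y)).1
  refine (mem_flagPartition.1 (hβ x)).2 ?_
  have h := M.closure_subset_closure hsub (hC.mem_closure_sdiff_singleton_of_mem hxC)
  rwa [flag_eq_closure, M.closure_closure, ← flag_eq_closure] at h

end Nbc

end OrlikSolomon

namespace OrlikSolomon

/-! ### The annihilator of the Orlik–Solomon ideal. -/

section Annihilator

variable {R : Type*} [CommRing R] {n : ℕ} {M : Matroid (Fin n)}

theorem mul_diff_mono_mul_mem_osIdeal {S : Finset (Fin n)} (hS : M.Dep (S : Set (Fin n)))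
    (x y : Ext R n) : x * diff R n (mono R S) * y ∈ osIdeal R M := by
  rw [osIdeal, TwoSidedIdeal.mem_asIdeal]
  exact TwoSidedIdeal.mul_mem_right _ _ _
    (TwoSidedIdeal.mul_mem_left _ _ _ (TwoSidedIdeal.subset_span ⟨S, hS, rfl⟩))

/-- Differentiating e_i e_S = 0 for i in S gives e_S = e_i ∂(e_S). -/
theorem mul_mono_mul_mem_osIdeal {S : Finset (Fin n)} (hS : M.Dep (S : Set (Fin n)))
    (x y : Ext R n) : x * mono R S * y ∈ osIdeal R M := by
  obtain ⟨i, hi⟩ := hS.nonempty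
  have h := congrArg (diff R n) (gen_mul_mono_of_mem (R := R) hi)
  rw [diff_gen_mul, map_zero, sub_eq_zero] at h
  rw [h, ← mul_assoc]
  exact mul_diff_mono_mul_mem_osIdeal hS _ _

/-- The factor x makes the set of killed elements a two-sided ideal, so testing the generators
suffices. -/
theorem mem_annih_osIdeal {a : Ext R n}
    (h : ∀ S : Finset (Fin n), M.Dep (S : Set (Fin n)) → ∀ x, a * x * diff R n (mono R S) = 0) :
    a ∈ annih R (osIdeal R M) := by
  let K : TwoSidedIdeal (Ext R n) := TwoSidedIdeal.mk' {b | ∀ x, a * x * b = 0}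
    (fun x => mul_zero _)
    (fun {b c} hb hc x => by rw [mul_add, hb x, hc x, add_zero])
    (fun {b} hb x => by rw [mul_neg, hb x, neg_zero])
    (fun {c b} hb x => by rw [← mul_assoc, mul_assoc a, hb])
    (fun {b c} hb x => by rw [← mul_assoc, hb x, zero_mul])
  have hK : TwoSidedIdeal.span {b | ∃ S : Finset (Fin n), M.Dep (S : Set (Fin n)) ∧
      b = diff R n (mono R S)} ≤ K := by
    rw [TwoSidedIdeal.span_le]
    rintro _ ⟨S, hS, rfl⟩
    exact (TwoSidedIdeal.mem_mk' _ _ _ _ _ _ _).2 (h S hS)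
  intro b hb
  have := (TwoSidedIdeal.mem_mk' _ _ _ _ _ _ _).1 (hK (TwoSidedIdeal.mem_asIdeal.1 hb)) 1
  rwa [mul_one] at this

/-- A weight on monomials that grows when indices are lowered or added. -/
def weight (S : Finset (Fin n)) : ℕ := ∑ i ∈ S, (n - i)

theorem weight_le (S : Finset (Fin n)) : weight S ≤ weight (Finset.univ : Finset (Fin n)) :=
  Finset.sum_le_sum_of_subset (Finset.subset_univ S)

theorem weight_lt_weight_insert_erase {S : Finset (Fin n)} {x y : Fin n} (hx : x ∉ S) (hy : y ∈ S)
    (hxy : x < y) : weight S < weight (insert x (S.erase y)) := by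
  have h := Finset.add_sum_erase S (fun i : Fin n => n - (i : ℕ)) hy
  rw [weight, weight, Finset.sum_insert (by simp [hx]), ← h]
  have : (x : ℕ) < y := hxy
  have := y.is_lt
  omega

/-- An element of the annihilator that pairs to zero with all nbc-monomials is zero. -/
theorem eq_zero_of_vol_mul_mono_nbc (hE : M.E = Set.univ) {a : Ext R n}
    (ha : a ∈ annih R (osIdeal R M)) (h : ∀ S, IsNbc M S → vol R n (a * mono R S) = 0) :
    a = 0 := by
  classical
  refine eq_zero_of_vol_mul_mono fun S => ?_
  -- Downward induction on weight: straightening replaces S by heavier sets.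
  induction S using (measure fun S : Finset (Fin n) =>
    weight (Finset.univ : Finset (Fin n)) - weight S).wf.induction with
  | _ S ih =>
  by_cases hS : IsNbc M S
  · exact h S hS
  replace ih : ∀ S', weight S < weight S' → vol R n (a * mono R S') = 0 := fun S' hS' =>
    ih S' (by
      have := weight_le S'
      change weight (Finset.univ : Finset (Fin n)) - weight S' < weight Finset.univ - weight S
      omega)
  rw [IsNbc] at hS
  push Not at hS
  obtain ⟨_, ⟨C, x, hC, hx, rfl⟩, hCS⟩ := hS
  obtain ⟨D, hxD, hD⟩ : ∃ D : Finset (Fin n), x ∉ D ∧ (D : Set (Fin n)) = C \ {x} :=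
    ⟨C.toFinset.erase x, by simp, by simp⟩
  have hDx : ((insert x D : Finset (Fin n)) : Set (Fin n)) = C := by
    rw [Finset.coe_insert, hD, Set.insert_sdiff_singleton, Set.insert_eq_of_mem hx.1]
  have hdep : M.Dep ((insert x D : Finset (Fin n)) : Set (Fin n)) := hDx ▸ hC.dep
  have hDS : D ⊆ S := by rwa [← Finset.coe_subset, hD]
  have hlt : ∀ y ∈ D, x < y := fun y hy => by
    have hy' : y ∈ C \ {x} := hD ▸ hy
    exact lt_of_le_of_ne (hx.2 hy'.1) (Ne.symm hy'.2)
  by_cases hxS : x ∈ S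
  · have hSdep : M.Dep (S : Set (Fin n)) :=
      hdep.superset (by exact_mod_cast Finset.insert_subset hxS hDS)
        (by simp [hE])
    have := ha _ (mul_mono_mul_mem_osIdeal (R := R) hSdep 1 1)
    rw [one_mul, mul_one] at this
    rw [this, map_zero]
  · have hS_eq : D ∪ S \ D = S := Finset.union_sdiff_of_subset hDS
    have hmS : EqUpToSign (a * mono R S) (a * (mono R D * mono R (S \ D))) := by
      refine EqUpToSign.mul (.refl a) (EqUpToSign.symm ?_)
      have := mono_mul_mono (R := R) (Finset.disjoint_sdiff : Disjoint D (S \ D))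
      rwa [hS_eq] at this
    refine (EqUpToSign.map (vol R n) hmS).eq_zero ?_
    -- The straightening relation: the first term is ±∂(e_C), which lies in I; the second exchanges
    -- some y in D for the smaller x, raising the weight.
    have hmD : mono R D = diff R n (gen R x * mono R D) + gen R x * diff R n (mono R D) := by
      rw [diff_gen_mul, sub_add_cancel]
    have hzero : a * (diff R n (gen R x * mono R D) * mono R (S \ D)) = 0 := by
      refine (EqUpToSign.mul (.refl a) (EqUpToSign.mul
        (EqUpToSign.map (diff R n) (gen_mul_mono hxD)) (.refl _))).eq_zero ?_
      have := ha _ (mul_diff_mono_mul_mem_osIdeal (R := R) hdep 1 (mono R (S \ D)))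
      rwa [one_mul] at this
    rw [hmD, add_mul, mul_add, hzero, zero_add]
    have key : ∀ y ∈ Submodule.span R ((fun j => mono R (D.erase j)) '' (D : Set (Fin n))),
        vol R n (a * (gen R x * y * mono R (S \ D))) = 0 := by
      intro y hy
      induction hy using Submodule.span_induction with
      | mem y hy =>
        obtain ⟨j, hj, rfl⟩ := hy
        have hj : j ∈ D := hj
        have hdisj : Disjoint (insert x (D.erase j)) (S \ D) := by
          rw [Finset.disjoint_insert_left]
          exact ⟨by simp [hxS], Finset.disjoint_sdiff.mono_left (Finset.erase_subset _ _)⟩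
        have hunion : insert x (D.erase j) ∪ S \ D = insert x (S.erase j) := by
          rw [Finset.insert_union]
          congr 1
          ext i
          have := @hDS i
          simp only [Finset.mem_union, Finset.mem_erase, Finset.mem_sdiff]
          by_cases hij : i = j
          · simp [hij, hj]
          · by_cases hi : i ∈ D <;> simp [hij, hi, this]
        have hsign := (EqUpToSign.mul (gen_mul_mono (R := R) (i := x) (S := D.erase j)
          (by simp [hxD])) (.refl (mono R (S \ D)))).trans (mono_mul_mono hdisj)
        rw [hunion] at hsign
        exact (EqUpToSign.map (vol R n) (EqUpToSign.mul (.refl a) hsign)).eq_zero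
          (ih _ (weight_lt_weight_insert_erase hxS (hDS hj) (hlt j hj)))
      | zero => simp
      | add y z _ _ hy hz => rw [mul_add, add_mul, mul_add, map_add, hy, hz, add_zero]
      | smul r y _ hy =>
        rw [mul_smul_comm, smul_mul_assoc, mul_smul_comm, map_smul, hy, smul_zero]
    exact key _ (diff_mono_mem_span D)

theorem HasParity.mul_genProd {a : Ext R n} (ha : HasParity a) (l : List (Fin n)) :
    EqUpToSign (a * genProd R l) (genProd R l * a) := by
  induction l with
  | nil => rw [genProd_nil, mul_one, one_mul]; exact .refl _
  | cons i l ih =>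
    rw [genProd_cons, ← mul_assoc]
    refine (EqUpToSign.mul (ha.mul_ι _) (.refl _)).trans ?_
    rw [mul_assoc, mul_assoc]
    exact EqUpToSign.mul (.refl _) ih

/-- The element that separates `e_S` from the other nbc-monomials: the multiple `e_{T \ S} z` of
the generator `z` of `I⁰` given by an nbc-base `T ⊇ S`. -/
theorem mono_sdiff_mul_blockProd_mul_mono (M : Matroid (Fin n)) (T S S' : Finset (Fin n)) :
    EqUpToSign (mono R (T \ S) * blockProd R (flagPartition (flag M T)) * mono R S')
      (blockProd R (flagPartition (flag M T)) * (mono R (T \ S) * mono R S')) := by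
  rw [← mul_assoc]
  exact EqUpToSign.mul ((hasParity_blockProd _).mul_genProd _).symm (.refl _)

/-- The two monomials multiply to ±e_T, and T is a transversal of its own flag partition. -/
theorem mono_sdiff_mul_blockProd_mul_mono_self (hE : M.E = Set.univ) (hM : IsSimple M)
    {T S : Finset (Fin n)} (hT : IsNbcBase M T) (hST : S ⊆ T) :
    EqUpToSign (vol R n (mono R (T \ S) * blockProd R (flagPartition (flag M T)) * mono R S))
      1 := by
  rw [← vol_mono_univ (R := R) (n := n)]
  refine EqUpToSign.map (vol R n) ((mono_sdiff_mul_blockProd_mul_mono M T S S).trans ?_)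
  refine (EqUpToSign.mul (.refl _) (mono_mul_mono Finset.sdiff_disjoint)).trans ?_
  rw [Finset.sdiff_union_of_subset hST]
  exact blockProd_mul_mono_transversal
    (fun p q hpq => disjoint_flagPartition (flag_monotone M T) hpq)
    (exists_mem_flagPartition_flag hE hM hT) (decreasingEnum_mem_flagPartition hE hT.1)
    fun x => exists_decreasingEnum_eq.symm

/-- Nonvanishing forces (T \ S) ∪ S' to meet each block at most once. Sending an element of S' to
the least element of its block, which lies in T, then injects S' into S without raising any index;
equal weights would force S' = S. -/
theorem weight_lt_weight_of_mul_ne_zero (hE : M.E = Set.univ) (hM : IsSimple M)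
    {T S S' : Finset (Fin n)} (hT : IsNbcBase M T) (hne : S' ≠ S)
    (h : mono R (T \ S) * blockProd R (flagPartition (flag M T)) * mono R S' ≠ 0) :
    weight S' < weight S := by
  choose β hβ using exists_mem_flagPartition_flag hE hM hT
  have h1 : blockProd R (flagPartition (flag M T)) * (mono R (T \ S) * mono R S') ≠ 0 :=
    fun h0 => h ((mono_sdiff_mul_blockProd_mul_mono M T S S').eq_zero h0)
  have hdisj : Disjoint (T \ S) S' := by
    by_contra hd
    rw [mono_mul_mono_eq_zero hd, mul_zero] at h1
    exact h1 rfl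
  have h2 : blockProd R (flagPartition (flag M T)) * mono R (T \ S ∪ S') ≠ 0 :=
    fun h0 => h1 ((EqUpToSign.mul (.refl _) (mono_mul_mono hdisj)).eq_zero h0)
  have hinj : ∀ p, ∀ i ∈ T \ S ∪ S', ∀ j ∈ T \ S ∪ S', i ∈ flagPartition (flag M T) p →
      j ∈ flagPartition (flag M T) p → i = j := by
    intro p i hi j hj hip hjp
    by_contra hij
    exact h2 (blockProd_mul_mono hip hjp hij hi hj)
  set φ : Fin n → Fin n := fun x => decreasingEnum T (β x)
  have hφle : ∀ x, φ x ≤ x := fun x => decreasingEnum_le_of_mem_flagPartition hT.1 (hβ x)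
  -- Otherwise φ x lies in T \ S and shares a block with x, so the two coincide, although T \ S and
  -- S' are disjoint.
  have hφS : ∀ x ∈ S', φ x ∈ S := by
    intro x hx
    by_contra hxS
    have hmem : φ x ∈ T \ S := Finset.mem_sdiff.2 ⟨exists_decreasingEnum_eq.1 ⟨_, rfl⟩, hxS⟩
    have := hinj (β x) (φ x) (Finset.mem_union_left _ hmem) x (Finset.mem_union_right _ hx)
      (decreasingEnum_mem_flagPartition hE hT.1 _) (hβ x)
    exact Finset.disjoint_left.1 hdisj (this ▸ hmem) hx
  have hφinj : Set.InjOn φ S' := by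
    intro x hx y hy hxy
    have hβxy : β x = β y := (decreasingEnum_strictAnti T).injective hxy
    exact hinj (β x) x (Finset.mem_union_right _ hx) y (Finset.mem_union_right _ hy) (hβ x)
      (hβxy ▸ hβ y)
  have himg : S'.image φ ⊆ S := Finset.image_subset_iff.2 hφS
  have hw : weight (S'.image φ) = ∑ x ∈ S', (n - (φ x : ℕ)) := Finset.sum_image hφinj
  have hle : ∀ x ∈ S', n - (x : ℕ) ≤ n - (φ x : ℕ) := fun x _ => Nat.sub_le_sub_left (hφle x) n
  have hwle : weight (S'.image φ) ≤ weight S := Finset.sum_le_sum_of_subset himg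
  by_cases hfix : ∀ x ∈ S', φ x = x
  · have hS' : S'.image φ = S' := by
      rw [Finset.image_congr (fun x hx => hfix x hx), Finset.image_id']
    rw [hS'] at himg
    obtain ⟨y, hyS, hyS'⟩ := Finset.exists_of_ssubset (lt_of_le_of_ne himg hne)
    -- Indices are below n, so each weight term is positive and a proper subset weighs strictly
    -- less.
    exact Finset.sum_lt_sum_of_subset himg hyS hyS' (by have := y.is_lt; omega)
      fun _ _ _ => Nat.zero_le _
  · push Not at hfix
    obtain ⟨x, hx, hxne⟩ := hfix
    refine lt_of_lt_of_le ?_ hwle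
    rw [hw]
    refine Finset.sum_lt_sum hle ⟨x, hx, ?_⟩
    have : φ x < x := lt_of_le_of_ne (hφle x) hxne
    rw [Fin.lt_def] at this
    have := x.is_lt
    omega

theorem blockProd_flagPartition_mem_annih (hE : M.E = Set.univ) (hM : IsSimple M)
    {T : Finset (Fin n)} (hT : IsNbcBase M T) :
    blockProd R (flagPartition (flag M T)) ∈ annih R (osIdeal R M) := by
  refine mem_annih_osIdeal fun S hS x => ?_
  obtain ⟨p, i, hi, j, hj, hij, hip, hjp⟩ := exists_ne_mem_flagPartition_of_dep hE hM hT hS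
  exact blockProd_mul_mul_diff_mono hip hjp hij hi hj x

theorem annih_osIdeal_eq_span_blockProd (hE : M.E = Set.univ) (hM : IsSimple M) :
    annih R (osIdeal R M) = Ideal.span {a | ∃ T : Finset (Fin n), IsNbcBase M T ∧
      a = blockProd R (flagPartition (flag M T))} := by
  classical
  refine le_antisymm ?_ (Ideal.span_le.2 ?_)
  · set J := Ideal.span {a | ∃ T : Finset (Fin n), IsNbcBase M T ∧
      a = blockProd R (flagPartition (flag M T))}
    have hJ : J ≤ annih R (osIdeal R M) := Ideal.span_le.2 <| by
      rintro _ ⟨T, hT, rfl⟩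
      exact blockProd_flagPartition_mem_annih hE hM hT
    choose! T hT using fun S (hS : IsNbc M S) => hS.exists_isNbcBase_superset hE
    let f : Finset (Fin n) → Ext R n := fun S =>
      mono R (T S \ S) * blockProd R (flagPartition (flag M (T S)))
    have hfJ : ∀ S, IsNbc M S → f S ∈ J := fun S hS =>
      J.mul_mem_left _ (Ideal.subset_span ⟨T S, (hT S hS).1, rfl⟩)
    have hself : ∀ S, IsNbc M S → EqUpToSign (vol R n (f S * mono R S)) 1 := fun S hS =>
      mono_sdiff_mul_blockProd_mul_mono_self hE hM (hT S hS).1 (hT S hS).2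
    have hoff : ∀ S S', IsNbc M S → S' ≠ S → weight S ≤ weight S' → f S * mono R S' = 0 := by
      intro S S' hS hne hw
      by_contra h
      exact absurd (weight_lt_weight_of_mul_ne_zero hE hM (hT S hS).1 hne h) (not_lt.2 hw)
    -- Elimination from the heaviest nbc-sets down: each step clears the pairings at weight N
    -- without disturbing the heavier ones.
    have key : ∀ N : ℕ, ∀ a ∈ annih R (osIdeal R M),
        (∀ S, IsNbc M S → N ≤ weight S → vol R n (a * mono R S) = 0) → a ∈ J := by
      intro N
      induction N with
      | zero =>
        intro a ha h
        rw [eq_zero_of_vol_mul_mono_nbc hE ha fun S hS => h S hS (Nat.zero_le _)]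
        exact zero_mem _
      | succ N ih =>
        intro a ha h
        set F : Finset (Finset (Fin n)) :=
          Finset.univ.filter fun S => IsNbc M S ∧ weight S = N
        -- The diagonal pairing is ±1, its own inverse, so multiplying by it replaces division.
        set c : Ext R n :=
          ∑ S ∈ F, (vol R n (a * mono R S) * vol R n (f S * mono R S)) • f S
        have hcJ : c ∈ J := sum_mem fun S hS =>
          Submodule.smul_of_tower_mem J _ (hfJ S (Finset.mem_filter.1 hS).2.1)
        rw [← sub_add_cancel a c]
        refine add_mem (ih _ (sub_mem ha (hJ hcJ)) fun S hS hNS => ?_) hcJ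
        rw [sub_mul, map_sub, sub_eq_zero, Finset.sum_mul, map_sum]
        simp only [smul_mul_assoc, map_smul, smul_eq_mul]
        have hoff' : ∀ S' ∈ F, S' ≠ S → vol R n (a * mono R S') * vol R n (f S' * mono R S') *
            vol R n (f S' * mono R S) = 0 := by
          intro S' hS' hne
          obtain ⟨-, hS'nbc, hS'w⟩ := Finset.mem_filter.1 hS'
          rw [hoff S' S hS'nbc hne.symm (hS'w ▸ hNS), map_zero, mul_zero]
        by_cases hSF : S ∈ F
        · rw [Finset.sum_eq_single_of_mem S hSF hoff', mul_assoc]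
          obtain ⟨u, hu⟩ := hself S hS
          rw [hu, smul_mul_smul_comm, ← Units.val_mul, Int.units_mul_self]
          simp
        · have hlt : N + 1 ≤ weight S := lt_of_le_of_ne hNS fun hN =>
            hSF (Finset.mem_filter.2 ⟨Finset.mem_univ _, hS, hN.symm⟩)
          rw [h S hS hlt, Finset.sum_eq_zero fun S' hS' =>
            hoff' S' hS' fun hSS' => hSF (hSS' ▸ hS')]
    exact fun a ha => key (weight (Finset.univ : Finset (Fin n)) + 1) a ha fun S _ hw =>
      absurd (weight_le S) (by omega)
  · rintro _ ⟨T, hT, rfl⟩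
    exact blockProd_flagPartition_mem_annih hE hM hT

theorem span_z_eq_span_blockProd (M : Matroid (Fin n)) :
    Ideal.span {a | ∃ T : Finset (Fin n), IsNbcBase M T ∧ a = z R M T} =
      Ideal.span {a | ∃ T : Finset (Fin n), IsNbcBase M T ∧
        a = blockProd R (flagPartition (flag M T))} := by
  refine le_antisymm (Ideal.span_le.2 ?_) (Ideal.span_le.2 ?_)
  · rintro _ ⟨T, hT, rfl⟩
    exact (zPartition_eqUpToSign _).mem_iff.2 (Ideal.subset_span ⟨T, hT, rfl⟩)
  · rintro _ ⟨T, hT, rfl⟩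
    exact (zPartition_eqUpToSign _).mem_iff.1 (Ideal.subset_span ⟨T, hT, rfl⟩)

end Annihilator

end OrlikSolomon

theorem corollary3p5 {R : Type*} [CommRing R] {n : ℕ} (M : Matroid (Fin n))
    (hE : M.E = Set.univ) (hM : OrlikSolomon.IsSimple M) :
    OrlikSolomon.annih R (OrlikSolomon.osIdeal R M) =
        Ideal.span {a | ∃ T : Finset (Fin n), OrlikSolomon.IsNbcBase M T ∧
          a = OrlikSolomon.z R M T} ∧
      OrlikSolomon.IsPureIdeal R (OrlikSolomon.annih R (OrlikSolomon.osIdeal R M)) := by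
  have h := OrlikSolomon.annih_osIdeal_eq_span_blockProd (R := R) hE hM
  -- Purity is read off the generators without their signs; each block is nonempty because it
  -- contains an element of T.
  refine ⟨h.trans (OrlikSolomon.span_z_eq_span_blockProd M).symm, _, ?_, h⟩
  rintro _ ⟨T, hT, rfl⟩
  exact OrlikSolomon.isPure_blockProd fun p =>
    ⟨_, OrlikSolomon.decreasingEnum_mem_flagPartition hE hT.1 p⟩
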